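/- Let $\mathbb{T}^\infty$ be the countably infinite product of unit circles with its normalised Haar measure $d\theta$, let $\mathbb{Z}_0^\infty$ be the set of integer sequences $\nu=(\nu_1,\nu_2,\dots)$ with only finitely many non-zero entries, and let $\mathbb{N}_0^\infty\subset\mathbb{Z}_0^\infty$ be the set of those with all $\nu_j\ge 0$. For $f\in L^1(\mathbb{T}^\infty)$ put $\widehat f(\nu)=\int_{\mathbb{T}^\infty} f(e^{i\theta})e^{-i\nu\cdot\theta}\,d\theta$ for $\nu\in\mathbb{Z}_0^\infty$, and let $H^1(\mathbb{T}^\infty)$ be the space of all $f\in L^1(\mathbb{T}^\infty)$ with $\widehat f(\nu)=0$ for every $\nu\in\mathbb{Z}_0^\infty\setminus\mathbb{N}_0^\infty$, with the norm $\|f\|_{H^1}=\int_{\mathbb{T}^\infty}|f|\,d\theta$. Let $\mu\sim\sum_{\nu\in\mathbb{Z}_0^\infty}\widehat\mu(\nu)e^{i\nu\cdot\theta}$ be a formal Fourier series, that is, an arbitrary family of complex coefficients $\widehat\mu(\nu)$, and suppose that $\widehat\mu(\nu)=0$ for $\nu\notin\mathbb{N}_0^\infty$. For $m\ge 1$ let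 its $m$-th section ("$m$te Abschnitt") be the formal Fourier series $$A_m\mu\sim\sum_{\eta\in\mathbb{Z}^m}\widehat\mu(\widetilde\eta)e^{i\widetilde\eta\cdot\theta},\qquad \widetilde\eta=(\eta_1,\dots,\eta_m,0,0,\dots).$$ Assume that there is a real constant $C$ such that, for every $m\ge 1$, $A_m\mu$ is the Fourier series of an element of $H^1(\mathbb{T}^\infty)$ of norm at most $C$. Then $\mu$ is the Fourier series of some $f\in H^1(\mathbb{T}^\infty)$ with $\|f\|_{H^1}\le C$. -/

import Mathlib

open MeasureTheory

noncomputable section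

namespace InfTorus

/-- The infinite torus `𝕋^∞`; the `j`-th coordinate `θ j ∈ ℝ / ℤ` stands for the point
`exp (2 π i θ j)` of the unit circle. -/
abbrev Torus : Type := ℕ → UnitAddCircle

/-- The normalised Haar measure `dθ = dθ₁ × dθ₂ × ⋯` of `𝕋^∞`: the product of the normalised
Haar measures of the factors. -/
def haar : Measure Torus :=
  Measure.infinitePi fun _ : ℕ => (AddCircle.haarAddCircle : Measure UnitAddCircle)

instance : IsProbabilityMeasure haar :=
  inferInstanceAs (IsProbabilityMeasure (Measure.infinitePi fun _ : ℕ =>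
    (AddCircle.haarAddCircle : Measure UnitAddCircle)))

/-- The multi-indices `ℤ₀^∞`: integer sequences with finitely many non-zero entries. -/
abbrev MultiIndex : Type := ℕ →₀ ℤ

/-- The multi-indices that belong to `ℕ₀^∞`. -/
def analyticIndices : Set MultiIndex := {ν | ∀ j, 0 ≤ ν j}

/-- The character `e^{i ν · θ}` of `𝕋^∞`, a finite product of one-variable characters. -/
def character (ν : MultiIndex) (θ : Torus) : ℂ :=
  ∏ j ∈ ν.support, fourier (ν j) (θ j)

/-- The `ν`-th Fourier coefficient of a function on `𝕋^∞`. -/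
def fourierCoefficient (f : Torus → ℂ) (ν : MultiIndex) : ℂ :=
  ∫ θ, starRingEnd ℂ (character ν θ) * f θ ∂haar

theorem continuous_character (ν : MultiIndex) : Continuous (character ν) := by
  unfold character
  fun_prop

theorem norm_character (ν : MultiIndex) (θ : Torus) : ‖character ν θ‖ = 1 := by
  rw [character, norm_prod]
  exact Finset.prod_eq_one fun j _ => by rw [fourier_apply]; exact Circle.norm_coe _

theorem integrable_conj_character_mul (ν : MultiIndex) {f : Torus → ℂ}
    (hf : Integrable f haar) :
    Integrable (fun θ => starRingEnd ℂ (character ν θ) * f θ) haar := by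
  refine hf.bdd_mul (c := 1) ?_ ?_
  · exact (Complex.continuous_conj.comp (continuous_character ν)).aestronglyMeasurable
  · exact Filter.Eventually.of_forall fun θ => by simp [norm_character]

/-- The Hardy space `H¹(𝕋^∞)`: the functions in `L¹(𝕋^∞)` all of whose Fourier coefficients
outside `ℕ₀^∞` vanish, with the `L¹` norm. -/
def H1 : Submodule ℂ (Lp ℂ 1 haar) where
  carrier := {f | ∀ ν, ν ∉ analyticIndices → fourierCoefficient f ν = 0}
  zero_mem' := by
    intro ν _
    have h : (fun θ => starRingEnd ℂ (character ν θ) * (0 : Lp ℂ 1 haar) θ) =ᵐ[haar]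
        fun _ => (0 : ℂ) := by
      filter_upwards [Lp.coeFn_zero ℂ 1 haar] with θ hθ
      rw [hθ, Pi.zero_apply, mul_zero]
    rw [fourierCoefficient, integral_congr_ae h, integral_zero]
  add_mem' := by
    intro f g hf hg ν hν
    have h : (fun θ => starRingEnd ℂ (character ν θ) * (f + g) θ) =ᵐ[haar]
        fun θ => starRingEnd ℂ (character ν θ) * f θ + starRingEnd ℂ (character ν θ) * g θ := by
      filter_upwards [Lp.coeFn_add f g] with θ hθ
      rw [hθ, Pi.add_apply, mul_add]
    rw [fourierCoefficient, integral_congr_ae h,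
      integral_add (integrable_conj_character_mul ν (L1.integrable_coeFn f))
        (integrable_conj_character_mul ν (L1.integrable_coeFn g))]
    have h1 := hf ν hν
    have h2 := hg ν hν
    rw [fourierCoefficient] at h1 h2
    rw [h1, h2, add_zero]
  smul_mem' := by
    intro c f hf ν hν
    have h : (fun θ => starRingEnd ℂ (character ν θ) * (c • f) θ) =ᵐ[haar]
        fun θ => c * (starRingEnd ℂ (character ν θ) * f θ) := by
      filter_upwards [Lp.coeFn_smul c f] with θ hθ
      rw [hθ, Pi.smul_apply, smul_eq_mul]
      ring
    have h1 := hf ν hν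
    rw [fourierCoefficient] at h1
    rw [fourierCoefficient, integral_congr_ae h, integral_const_mul, h1, mul_zero]

/-- A formal Fourier series `∑ a_ν e^{i ν · θ}` over `ν ∈ ℤ₀^∞`, given by its coefficients, on
which no summability or growth condition is imposed. -/
abbrev FormalFourierSeries : Type := MultiIndex → ℂ

/-- The spectrum of a formal Fourier series: the indices with non-zero coefficient. -/
def spectrum (a : FormalFourierSeries) : Set MultiIndex := {ν | a ν ≠ 0}

open Classical in
/-- The `m`-te Abschnitt `A_m`: only the terms whose index is of the form
`(η₁, …, η_m, 0, 0, …)` are kept (coordinates are numbered from `0` here). -/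
def abschnitt (m : ℕ) (a : FormalFourierSeries) : FormalFourierSeries :=
  fun ν => if ∀ j, m ≤ j → ν j = 0 then a ν else 0

/-- `f ∼ ∑ a_ν e^{i ν · θ}`: the formal series `a` is the Fourier series of `f`. -/
def HasFourierSeries (f : Torus → ℂ) (a : FormalFourierSeries) : Prop :=
  ∀ ν, fourierCoefficient f ν = a ν

end InfTorus

end

/-! The sections form a Cauchy sequence in L¹. If `f` is analytic and `g` is its `m`-th section,
then ‖f - g‖ ≤ κ(‖f‖ - ‖g‖) + κ⁻¹‖f‖ for every κ > 0. Letting κ → ∞ shows that the norms of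
successive sections increase. Being bounded by C, they converge, and the inequality with κ large but
fixed turns this into the Cauchy property (`cauchySeq_of_norm_sub_le`). The L¹ limit has
coefficients μ because Fourier coefficients are L¹-continuous.

The inequality comes from one variable (`integral_norm_eval_sub_le`): a polynomial factors as P = uv
on the closed disc with |u| = |v| on the circle, so ‖P‖₁ = ‖u‖₂² = ‖v‖₂² and the orthogonality of u
- u(0) to constants controls the deviation from the mean. For an analytic trigonometric polynomial
on the torus, rotating all variables from position `m` on by a common angle gives a polynomial in
e^{it} whose value at 0 is the section; integrating over the torus yields
`integral_norm_trigPoly_sub_abschnitt_le`. Fejér means commute with sections and converge in L¹,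
which extends the inequality to all analytic L¹ functions. -/

noncomputable section

namespace InfTorus

open Metric ComplexConjugate Filter Topology

/-! ### Balanced factorization and the deviation from the mean on the circle -/

section OneVariable

/-- The real part of 1 - cz is nonnegative on the closed disc, so the principal branch applies; at a
boundary zero, where cz = 1, the power 1/2 is still continuous. -/
theorem exists_sqrt_one_sub_mul {c : ℂ} (hc : ‖c‖ ≤ 1) :
    ∃ s : ℂ → ℂ, DiffContOnCl ℂ s (ball 0 1) ∧ ∀ z, s z * s z = 1 - c * z := by
  have hre : ∀ z : ℂ, 1 - ‖c‖ * ‖z‖ ≤ (1 - c * z).re := fun z => by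
    have h := (Complex.re_le_norm (c * z)).trans_eq (norm_mul c z)
    rw [Complex.sub_re, Complex.one_re]
    linarith
  refine ⟨fun z => (1 - c * z) ^ (1 / 2 : ℂ), ⟨?_, ?_⟩, fun z => ?_⟩
  · intro z hz
    have hz' : ‖z‖ < 1 := by simpa using hz
    have hpos : 0 < (1 - c * z).re := by
      nlinarith [hre z, norm_nonneg z, norm_nonneg c]
    refine DifferentiableAt.differentiableWithinAt ?_
    exact DifferentiableAt.cpow_const (by fun_prop) (Or.inl hpos)
  · rw [closure_ball _ one_ne_zero]
    intro z hz
    have hz' : ‖z‖ ≤ 1 := by simpa using hz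
    have hnn : 0 ≤ (1 - c * z).re := by
      nlinarith [hre z, norm_nonneg z, norm_nonneg c]
    refine ContinuousAt.continuousWithinAt ?_
    refine ContinuousAt.comp (f := fun z => 1 - c * z) (g := fun w : ℂ => w ^ (1 / 2 : ℂ)) ?_
      (by fun_prop)
    exact Complex.continuousAt_cpow_const_of_re_pos (Or.inl hnn) (by norm_num)
  · rw [← pow_two, ← Complex.cpow_nat_mul]
    norm_num

/-- On the closed unit disc, `f` is a product of two holomorphic functions whose absolute values
agree on the unit circle. -/
def HasBalancedFactorization (f : ℂ → ℂ) : Prop :=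
  ∃ u v : ℂ → ℂ, DiffContOnCl ℂ u (ball 0 1) ∧ DiffContOnCl ℂ v (ball 0 1) ∧
    (∀ z ∈ closedBall (0 : ℂ) 1, f z = u z * v z) ∧ ∀ z ∈ sphere (0 : ℂ) 1, ‖u z‖ = ‖v z‖

theorem HasBalancedFactorization.mul {f g : ℂ → ℂ} (hf : HasBalancedFactorization f)
    (hg : HasBalancedFactorization g) : HasBalancedFactorization (fun z => f z * g z) := by
  obtain ⟨u, v, hu, hv, h, h'⟩ := hf
  obtain ⟨u₁, v₁, hu₁, hv₁, h₁, h₁'⟩ := hg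
  refine ⟨fun z => u z * u₁ z, fun z => v z * v₁ z, hu.smul hu₁, hv.smul hv₁,
    fun z hz => ?_, fun z hz => ?_⟩
  · simp only [h z hz, h₁ z hz]
    ring
  · rw [norm_mul, norm_mul, h' z hz, h₁' z hz]

theorem hasBalancedFactorization_const (a : ℂ) : HasBalancedFactorization (fun _ => a) := by
  obtain ⟨b, hb⟩ := IsAlgClosed.exists_pow_nat_eq a (n := 2) two_pos
  exact ⟨fun _ => b, fun _ => b, diffContOnCl_const, diffContOnCl_const,
    fun _ _ => by rw [← hb, pow_two], fun _ _ => rfl⟩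

/-- For a zero inside the disc, |z - a| = |1 - āz| on the circle, so √(1 - āz) and (z - a)/√(1 - āz)
are balanced. Otherwise z - a = -a(1 - z/a), and √(1 - z/a) serves as both factors. -/
theorem hasBalancedFactorization_sub_const (a : ℂ) :
    HasBalancedFactorization (fun z => z - a) := by
  rcases lt_or_ge ‖a‖ 1 with ha | ha
  · obtain ⟨s, hs, hs2⟩ := exists_sqrt_one_sub_mul (c := conj a) (by simpa using ha.le)
    have hne : ∀ z ∈ closedBall (0 : ℂ) 1, s z ≠ 0 := fun z hz h0 => by
      have h1 : conj a * z = 1 := by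
        have := hs2 z
        rw [h0, mul_zero] at this
        exact (sub_eq_zero.1 this.symm).symm
      have h2 : ‖a‖ * ‖z‖ = 1 := by simpa using congrArg norm h1
      have h3 : ‖z‖ ≤ 1 := by simpa using hz
      nlinarith [norm_nonneg a, norm_nonneg z]
    refine ⟨fun z => (z - a) * (s z)⁻¹, s, ?_, hs, fun z hz => ?_, fun z hz => ?_⟩
    · refine (differentiable_id.sub_const a).diffContOnCl.smul (hs.inv fun z hz => hne z ?_)
      rwa [closure_ball _ one_ne_zero] at hz
    · rw [mul_assoc, inv_mul_cancel₀ (hne z hz), mul_one]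
    · have hz1 : ‖z‖ = 1 := by simpa using hz
      have hpos : 0 < ‖s z‖ := norm_pos_iff.2 (hne z (sphere_subset_closedBall hz))
      have hzz : z * conj z = 1 := by
        rw [Complex.mul_conj, Complex.normSq_eq_norm_sq, hz1]
        norm_num
      -- On the circle, z · conj (z - a) = 1 - āz.
      have h1 : ‖z - a‖ = ‖s z‖ * ‖s z‖ := by
        rw [← norm_mul, hs2, ← RCLike.norm_conj (z - a), ← one_mul ‖conj (z - a)‖, ← hz1,
          ← norm_mul, map_sub, mul_sub, hzz, mul_comm z]
      rw [norm_mul, norm_inv, h1, mul_assoc, mul_inv_cancel₀ hpos.ne', mul_one]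
  · have ha0 : a ≠ 0 := norm_pos_iff.1 (one_pos.trans_le ha)
    obtain ⟨s, hs, hs2⟩ := exists_sqrt_one_sub_mul (c := a⁻¹)
      (by rw [norm_inv]; exact inv_le_one_of_one_le₀ ha)
    have h : HasBalancedFactorization (fun z => 1 - a⁻¹ * z) :=
      ⟨s, s, hs, hs, fun z _ => (hs2 z).symm, fun _ _ => rfl⟩
    convert (hasBalancedFactorization_const (-a)).mul h using 2 with z
    field_simp
    ring

theorem hasBalancedFactorization_eval (P : Polynomial ℂ) :
    HasBalancedFactorization (fun z => P.eval z) := by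
  have key : ∀ s : Multiset ℂ, HasBalancedFactorization
      (fun z => ((s.map fun a => Polynomial.X - Polynomial.C a).prod).eval z) := by
    intro s
    induction s using Multiset.induction with
    | empty => simpa using hasBalancedFactorization_const 1
    | cons a s ih => simpa using (hasBalancedFactorization_sub_const a).mul ih
  have h := (IsAlgClosed.splits P).eq_prod_roots
  convert (hasBalancedFactorization_const P.leadingCoeff).mul (key P.roots) using 2 with z
  conv_lhs => rw [h]
  simp

/-- Mean value property on the circle `ℝ / ℤ`. -/
theorem integral_comp_fourier_one {u : ℂ → ℂ} (hu : DiffContOnCl ℂ u (ball 0 1)) :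
    ∫ t : UnitAddCircle, u (fourier 1 t) ∂AddCircle.haarAddCircle = u 0 := by
  have h := hu
  rw [show (1 : ℝ) = |1| from abs_one.symm] at h
  rw [← h.circleAverage, Real.circleAverage_def, AddCircle.integral_haarAddCircle,
    ← UnitAddCircle.intervalIntegral_preimage 0]
  have h2 := intervalIntegral.integral_comp_mul_left (a := 0) (b := 1)
    (fun x => u (circleMap 0 1 x)) (c := 2 * Real.pi) (by positivity)
  rw [mul_zero, mul_one] at h2
  rw [← h2, inv_one, one_smul, zero_add]
  congr 1
  ext x
  rw [fourier_coe_apply, circleMap]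
  congr 1
  push_cast
  simp only [mul_one, div_one, zero_add, one_mul]
  congr 1
  ring

theorem continuous_comp_fourier_one {u : ℂ → ℂ} (hu : DiffContOnCl ℂ u (ball 0 1)) :
    Continuous fun t : UnitAddCircle => u (fourier 1 t) := by
  refine hu.continuousOn.comp_continuous (fourier 1).continuous fun t => ?_
  rw [closure_ball _ one_ne_zero, mem_closedBall_zero_iff, fourier_apply, Circle.norm_coe]

theorem integrable_of_continuous_circle {E : Type*} [NormedAddCommGroup E] {g : UnitAddCircle → E}
    (hg : Continuous g) : Integrable g AddCircle.haarAddCircle :=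
  hg.integrable_of_hasCompactSupport (HasCompactSupport.of_compactSpace g)

/-- Pythagoras: U - a is orthogonal to the constants. -/
theorem integral_norm_sub_sq {U : UnitAddCircle → ℂ} (hc : Continuous U) {a : ℂ}
    (ha : ∫ t, U t ∂AddCircle.haarAddCircle = a) :
    ∫ t, ‖U t - a‖ ^ 2 ∂AddCircle.haarAddCircle =
      (∫ t, ‖U t‖ ^ 2 ∂AddCircle.haarAddCircle) - ‖a‖ ^ 2 := by
  have h1 : ∫ t, (U t * conj a).re ∂AddCircle.haarAddCircle = ‖a‖ ^ 2 := by
    have h := integral_re (𝕜 := ℂ) (f := fun t => U t * conj a)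
      (μ := AddCircle.haarAddCircle) (integrable_of_continuous_circle (by fun_prop))
    rw [integral_mul_const, ha, Complex.mul_conj, Complex.normSq_eq_norm_sq] at h
    exact h.trans (RCLike.ofReal_re _)
  have h2 : ∀ t, ‖U t - a‖ ^ 2 = ‖U t‖ ^ 2 + ‖a‖ ^ 2 - 2 * (U t * conj a).re := fun t => by
    rw [← Complex.normSq_eq_norm_sq, ← Complex.normSq_eq_norm_sq, ← Complex.normSq_eq_norm_sq,
      Complex.normSq_sub]
  simp_rw [h2]
  rw [integral_sub (integrable_of_continuous_circle (by fun_prop))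
      (integrable_of_continuous_circle (by fun_prop)),
    integral_add (integrable_of_continuous_circle (by fun_prop)) (integrable_const _),
    integral_const_mul, h1]
  simp
  ring

/-- A quantitative form of the triangle inequality in `H¹` of the circle: a polynomial whose norm
is close to the absolute value of its mean is close to its mean. -/
theorem integral_norm_eval_sub_le (P : Polynomial ℂ) {κ : ℝ} (hκ : 0 < κ) :
    ∫ t : UnitAddCircle, ‖P.eval (fourier 1 t : ℂ) - P.eval 0‖ ∂AddCircle.haarAddCircle ≤
      κ * ((∫ t : UnitAddCircle, ‖P.eval (fourier 1 t : ℂ)‖ ∂AddCircle.haarAddCircle)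
        - ‖P.eval 0‖)
      + κ⁻¹ * ∫ t : UnitAddCircle, ‖P.eval (fourier 1 t : ℂ)‖ ∂AddCircle.haarAddCircle := by
  obtain ⟨u, v, hu, hv, huv, hn⟩ := hasBalancedFactorization_eval P
  have hmem : ∀ t : UnitAddCircle, (fourier 1 t : ℂ) ∈ sphere (0 : ℂ) 1 := fun t => by
    rw [mem_sphere_zero_iff_norm, fourier_apply, Circle.norm_coe]
  have hP : ∀ t : UnitAddCircle, P.eval (fourier 1 t : ℂ) = u (fourier 1 t) * v (fourier 1 t) :=
    fun t => huv _ (sphere_subset_closedBall (hmem t))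
  have hu2 := integral_norm_sub_sq (continuous_comp_fourier_one hu) (integral_comp_fourier_one hu)
  have hv2 := integral_norm_sub_sq (continuous_comp_fourier_one hv) (integral_comp_fourier_one hv)
  have hcu := continuous_comp_fourier_one hu
  have hcv := continuous_comp_fourier_one hv
  have hn' : ∀ t : UnitAddCircle, ‖u (fourier 1 t)‖ = ‖v (fourier 1 t)‖ := fun t => hn _ (hmem t)
  generalize hU : (fun t : UnitAddCircle => u (fourier 1 t)) = U at hcu
  generalize hV : (fun t : UnitAddCircle => v (fourier 1 t)) = V at hcv
  have hU' : ∀ t : UnitAddCircle, u (fourier 1 t) = U t := fun t => congrFun hU t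
  have hV' : ∀ t : UnitAddCircle, v (fourier 1 t) = V t := fun t => congrFun hV t
  simp only [hU', hV'] at hP hn' hu2 hv2
  have hP0 : P.eval 0 = u 0 * v 0 := huv 0 (by simp)
  set N := ∫ t : UnitAddCircle, ‖P.eval (fourier 1 t : ℂ)‖ ∂AddCircle.haarAddCircle with hN
  have hNu : ∫ t, ‖U t‖ ^ 2 ∂AddCircle.haarAddCircle = N := by
    refine integral_congr_ae (.of_forall fun t => ?_)
    simp only [hP, norm_mul, ← hn' t, pow_two]
  have hNv : ∫ t, ‖V t‖ ^ 2 ∂AddCircle.haarAddCircle = N := by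
    refine integral_congr_ae (.of_forall fun t => ?_)
    simp only [hP, norm_mul, hn' t, pow_two]
  rw [hNu] at hu2
  rw [hNv] at hv2
  have hu0 : ‖u 0‖ ^ 2 ≤ N := by
    have : 0 ≤ N - ‖u 0‖ ^ 2 := by rw [← hu2]; exact integral_nonneg fun t => by positivity
    linarith
  -- Weighted AM-GM in place of Cauchy–Schwarz keeps the bound linear in the norms, so that it can
  -- later be integrated over slices.
  have hpt : ∀ x y : ℝ, x * y ≤ (κ * x ^ 2 + κ⁻¹ * y ^ 2) / 2 := fun x y => by
    have h : 0 ≤ κ⁻¹ * (κ * x - y) ^ 2 := by positivity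
    have h' : κ⁻¹ * (κ * x - y) ^ 2 = κ * x ^ 2 + κ⁻¹ * y ^ 2 - 2 * (x * y) := by
      field_simp
      ring
    linarith
  have hle : ∀ t : UnitAddCircle, ‖P.eval (fourier 1 t : ℂ) - P.eval 0‖ ≤
      (κ * ‖U t - u 0‖ ^ 2 + κ⁻¹ * ‖V t‖ ^ 2) / 2 +
      (κ * ‖V t - v 0‖ ^ 2 + κ⁻¹ * ‖u 0‖ ^ 2) / 2 := fun t => by
    rw [hP, hP0, show U t * V t - u 0 * v 0 =
      (U t - u 0) * V t + (V t - v 0) * u 0 by ring]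
    refine (norm_add_le _ _).trans ?_
    rw [norm_mul, norm_mul]
    exact add_le_add (hpt _ _) (hpt _ _)
  calc ∫ t : UnitAddCircle, ‖P.eval (fourier 1 t : ℂ) - P.eval 0‖ ∂AddCircle.haarAddCircle
      ≤ ∫ t : UnitAddCircle, ((κ * ‖U t - u 0‖ ^ 2 +
            κ⁻¹ * ‖V t‖ ^ 2) / 2 +
          (κ * ‖V t - v 0‖ ^ 2 + κ⁻¹ * ‖u 0‖ ^ 2) / 2) ∂AddCircle.haarAddCircle := by
        refine integral_mono ?_ ?_ hle <;> refine integrable_of_continuous_circle ?_ <;> fun_prop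
    _ = (κ * (N - ‖u 0‖ ^ 2) + κ⁻¹ * N) / 2 + (κ * (N - ‖v 0‖ ^ 2) + κ⁻¹ * ‖u 0‖ ^ 2) / 2 := by
        rw [integral_add, integral_div, integral_div, integral_add, integral_add,
          integral_const_mul, integral_const_mul, integral_const_mul, hu2, hv2, hNv]
        · simp
        all_goals refine integrable_of_continuous_circle ?_; fun_prop
    _ ≤ κ * (N - ‖P.eval 0‖) + κ⁻¹ * N := by
        -- The term -κ(|u(0)|² + |v(0)|²)/2 is at most -κ|u(0)v(0)|.
        rw [hP0, norm_mul]
        have h1 : κ⁻¹ * ‖u 0‖ ^ 2 ≤ κ⁻¹ * N := by gcongr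
        have h2 : κ * (2 * (‖u 0‖ * ‖v 0‖)) ≤ κ * (‖u 0‖ ^ 2 + ‖v 0‖ ^ 2) := by
          gcongr
          nlinarith [sq_nonneg (‖u 0‖ - ‖v 0‖)]
        linarith

end OneVariable

/-! ### Characters of the infinite torus -/

section Characters

theorem character_eq_prod_of_subset {ν : MultiIndex} {s : Finset ℕ} (h : ν.support ⊆ s)
    (θ : Torus) : character ν θ = ∏ j ∈ s, fourier (ν j) (θ j) := by
  refine Finset.prod_subset h fun j _ hj => ?_
  rw [Finsupp.notMem_support_iff.1 hj, fourier_zero]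

@[simp]
theorem character_zero (θ : Torus) : character 0 θ = 1 := by
  simp [character]

theorem character_add (ν η : MultiIndex) (θ : Torus) :
    character (ν + η) θ = character ν θ * character η θ := by
  classical
  rw [character_eq_prod_of_subset Finsupp.support_add,
    character_eq_prod_of_subset (Finset.subset_union_left (s₂ := η.support)),
    character_eq_prod_of_subset (Finset.subset_union_right (s₁ := ν.support)),
    ← Finset.prod_mul_distrib]
  exact Finset.prod_congr rfl fun j _ => by rw [Finsupp.add_apply, fourier_add]

theorem character_neg (ν : MultiIndex) (θ : Torus) :
    character (-ν) θ = conj (character ν θ) := by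
  rw [character, character, map_prod, Finsupp.support_neg]
  exact Finset.prod_congr rfl fun j _ => by rw [Finsupp.neg_apply, fourier_neg]

theorem character_sub (ν η : MultiIndex) (θ : Torus) :
    character (ν - η) θ = character ν θ * conj (character η θ) := by
  rw [sub_eq_add_neg, character_add, character_neg]

theorem character_apply_add (ν : MultiIndex) (θ φ : Torus) :
    character ν (θ + φ) = character ν θ * character ν φ := by
  rw [character, character, character, ← Finset.prod_mul_distrib]
  refine Finset.prod_congr rfl fun j _ => ?_
  rw [fourier_apply, fourier_apply, fourier_apply, Pi.add_apply, smul_add,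
    AddCircle.toCircle_add, Circle.coe_mul]

theorem character_single_one (j : ℕ) (θ : Torus) :
    character (Finsupp.single j 1) θ = fourier 1 (θ j) := by
  rw [character, Finsupp.support_single _ one_ne_zero, Finset.prod_singleton,
    Finsupp.single_eq_same]

theorem exists_character_ne_one {ν : MultiIndex} (hν : ν ≠ 0) :
    ∃ φ : Torus, character ν φ ≠ 1 := by
  classical
  obtain ⟨j, hj⟩ := Finsupp.ne_iff.1 hν
  rw [Finsupp.zero_apply] at hj
  -- Half a period of the `j`-th factor, where the character equals -1.
  refine ⟨Pi.single j ((1 / 2 / (ν j : ℝ) : ℝ) : UnitAddCircle), ?_⟩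
  rw [character, Finset.prod_eq_single_of_mem j (Finsupp.mem_support_iff.2 hj), Pi.single_eq_same]
  · have h := fourier_add_half_inv_index (T := 1) hj one_pos 0
    rw [zero_add, fourier_eval_zero] at h
    rw [h]
    norm_num
  · intro i _ hi
    rw [Pi.single_eq_of_ne hi, fourier_eval_zero]

end Characters

/-! ### Invariance of the Haar measure and orthogonality of characters -/

section Haar

instance : haar.IsAddLeftInvariant := by
  refine ⟨fun φ => ?_⟩
  have h := Measure.infinitePi_map_pi (fun _ : ℕ =>
    (AddCircle.haarAddCircle : Measure UnitAddCircle)) (f := fun j x => φ j + x)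
    (fun j => measurable_const_add (φ j))
  simp only [map_add_left_eq_self] at h
  exact h

theorem integrable_of_continuous {E : Type*} [NormedAddCommGroup E] {f : Torus → E}
    (hf : Continuous f) : Integrable f haar := by
  have : SecondCountableTopologyEither Torus E := inferInstance
  exact hf.integrable_of_hasCompactSupport (HasCompactSupport.of_compactSpace f)

/-- Translation by φ multiplies the integral by `character ν φ`, which can be chosen different from
1 when ν ≠ 0. -/
theorem integral_character (ν : MultiIndex) :
    ∫ θ, character ν θ ∂haar = if ν = 0 then 1 else 0 := by
  split_ifs with hν
  · simp [hν]
  · obtain ⟨φ, hφ⟩ := exists_character_ne_one hν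
    have h := integral_add_left_eq_self (μ := haar) (character ν) φ
    simp only [character_apply_add] at h
    rw [integral_const_mul] at h
    by_contra h0
    exact hφ (mul_right_cancel₀ h0 (by rw [h, one_mul]))

theorem fourierCoefficient_character (ν η : MultiIndex) :
    fourierCoefficient (character ν) η = if η = ν then 1 else 0 := by
  have h : ∀ θ, conj (character η θ) * character ν θ = character (ν - η) θ := fun θ => by
    rw [character_sub, mul_comm]
  simp only [fourierCoefficient, h, integral_character, sub_eq_zero, eq_comm]

end Haar

/-! ### Slices of analytic polynomials and their sections -/

section AnalyticPolynomials

/-- The trigonometric polynomial with coefficients `a` and frequencies in `F`. -/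
def trigPoly (F : Finset MultiIndex) (a : FormalFourierSeries) (θ : Torus) : ℂ :=
  ∑ ν ∈ F, a ν * character ν θ

theorem continuous_trigPoly (F : Finset MultiIndex) (a : FormalFourierSeries) :
    Continuous (trigPoly F a) := by
  unfold trigPoly
  have := continuous_character
  fun_prop

/-- The element of the torus with coordinate `t` from the position `m` on and `0` before. -/
def tailShift (m : ℕ) (t : UnitAddCircle) : Torus := fun j => if m ≤ j then t else 0

theorem continuous_tailShift (m : ℕ) : Continuous (tailShift m) := by
  refine continuous_pi fun j => ?_
  by_cases h : m ≤ j
  · simp only [tailShift, if_pos h]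
    exact continuous_id
  · simp only [tailShift, if_neg h]
    exact continuous_const

/-- The total degree of a multi-index in the variables from the position `m` on. -/
def tailDegree (m : ℕ) (ν : MultiIndex) : ℤ := ∑ j ∈ ν.support with m ≤ j, ν j

theorem tailDegree_nonneg (m : ℕ) {ν : MultiIndex} (hν : ν ∈ analyticIndices) :
    0 ≤ tailDegree m ν :=
  Finset.sum_nonneg fun j _ => hν j

theorem tailDegree_eq_zero_iff (m : ℕ) {ν : MultiIndex} (hν : ν ∈ analyticIndices) :
    tailDegree m ν = 0 ↔ ∀ j, m ≤ j → ν j = 0 := by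
  rw [tailDegree, Finset.sum_eq_zero_iff_of_nonneg fun j _ => hν j]
  refine ⟨fun h j hj => ?_, fun h j hj => h j (Finset.mem_filter.1 hj).2⟩
  by_contra h0
  exact h0 (h j (Finset.mem_filter.2 ⟨Finsupp.mem_support_iff.2 h0, hj⟩))

theorem character_tailShift (m : ℕ) {ν : MultiIndex} (hν : ν ∈ analyticIndices)
    (t : UnitAddCircle) :
    character ν (tailShift m t) = (fourier 1 t : ℂ) ^ (tailDegree m ν).toNat := by
  have hpow : ∀ n : ℕ, (fourier 1 t : ℂ) ^ n = fourier (n : ℤ) t := fun n => by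
    induction n with
    | zero => rw [pow_zero, Nat.cast_zero, fourier_zero]
    | succ n ih => rw [pow_succ, ih, Nat.cast_succ, fourier_add]
  rw [hpow, Int.toNat_of_nonneg (tailDegree_nonneg m hν), tailDegree, character,
    ← Finset.prod_filter_mul_prod_filter_not ν.support (fun j => m ≤ j)]
  have h1 : ∏ j ∈ ν.support with ¬ m ≤ j, (fourier (ν j) (tailShift m t j) : ℂ) = 1 :=
    Finset.prod_eq_one fun j hj => by
      rw [tailShift, if_neg (Finset.mem_filter.1 hj).2, fourier_eval_zero]
  have h2 : ∏ j ∈ ν.support with m ≤ j, (fourier (ν j) (tailShift m t j) : ℂ) =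
      ∏ j ∈ ν.support with m ≤ j, (fourier (ν j) t : ℂ) :=
    Finset.prod_congr rfl fun j hj => by rw [tailShift, if_pos (Finset.mem_filter.1 hj).2]
  rw [h1, h2, mul_one]
  generalize ν.support.filter (fun j => m ≤ j) = s
  classical
  induction s using Finset.induction_on with
  | empty => simp
  | insert j s hj ih => rw [Finset.prod_insert hj, Finset.sum_insert hj, fourier_add, ih]

/-- The polynomial in `e^{it}` obtained by rotating all variables from the position `m` on. -/
def slicePoly (m : ℕ) (F : Finset MultiIndex) (a : FormalFourierSeries) (θ : Torus) :
    Polynomial ℂ :=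
  ∑ ν ∈ F, Polynomial.monomial (tailDegree m ν).toNat (a ν * character ν θ)

theorem eval_slicePoly (m : ℕ) (F : Finset MultiIndex) {a : FormalFourierSeries}
    (ha : spectrum a ⊆ analyticIndices) (θ : Torus) (t : UnitAddCircle) :
    (slicePoly m F a θ).eval (fourier 1 t : ℂ) = trigPoly F a (θ + tailShift m t) := by
  rw [slicePoly, Polynomial.eval_finsetSum, trigPoly]
  refine Finset.sum_congr rfl fun ν _ => ?_
  by_cases h : a ν = 0
  · simp [h]
  · rw [Polynomial.eval_monomial, character_apply_add, character_tailShift m (ha h), mul_assoc]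

theorem trigPoly_abschnitt_add_tailShift (m : ℕ) (F : Finset MultiIndex)
    (a : FormalFourierSeries) (θ : Torus) (t : UnitAddCircle) :
    trigPoly F (abschnitt m a) (θ + tailShift m t) = trigPoly F (abschnitt m a) θ := by
  refine Finset.sum_congr rfl fun ν _ => ?_
  rw [abschnitt]
  split_ifs with h
  · rw [character_apply_add]
    have h1 : character ν (tailShift m t) = 1 := Finset.prod_eq_one fun j _ => by
      by_cases hj : m ≤ j
      · rw [h j hj, fourier_zero]
      · rw [tailShift, if_neg hj, fourier_eval_zero]
    rw [h1, mul_one]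
  · rw [zero_mul, zero_mul]

/-- Evaluation at 0 keeps the terms of tail degree 0. Since the entries are nonnegative there is no
cancellation in the tail degree, so these are exactly the terms of the section. -/
theorem eval_zero_slicePoly (m : ℕ) (F : Finset MultiIndex) {a : FormalFourierSeries}
    (ha : spectrum a ⊆ analyticIndices) (θ : Torus) :
    (slicePoly m F a θ).eval 0 = trigPoly F (abschnitt m a) θ := by
  rw [slicePoly, Polynomial.eval_finsetSum, trigPoly]
  refine Finset.sum_congr rfl fun ν _ => ?_
  rw [Polynomial.eval_monomial, abschnitt]
  by_cases h : a ν = 0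
  · simp [h]
  · split_ifs with h0
    · rw [(tailDegree_eq_zero_iff m (ha h)).2 h0, Int.toNat_zero, pow_zero, mul_one]
    · rw [← tailDegree_eq_zero_iff m (ha h)] at h0
      have := tailDegree_nonneg m (ha h)
      rw [zero_pow (by omega), mul_zero, zero_mul]

theorem integrable_tailShift (m : ℕ) {G : Torus → ℝ} (hG : Continuous G) :
    Integrable (Function.uncurry fun (θ : Torus) (t : UnitAddCircle) => G (θ + tailShift m t))
      (haar.prod AddCircle.haarAddCircle) := by
  have hc : Continuous (Function.uncurry fun (θ : Torus) (t : UnitAddCircle) =>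
      G (θ + tailShift m t)) :=
    hG.comp (continuous_fst.add ((continuous_tailShift m).comp continuous_snd))
  exact hc.integrable_of_hasCompactSupport (HasCompactSupport.of_compactSpace _)

theorem integral_integral_tailShift (m : ℕ) {G : Torus → ℝ} (hG : Continuous G) :
    ∫ θ, ∫ t, G (θ + tailShift m t) ∂AddCircle.haarAddCircle ∂haar = ∫ θ, G θ ∂haar := by
  rw [integral_integral_swap (integrable_tailShift m hG)]
  simp [integral_add_right_eq_self (μ := haar) G]

/-- The one-variable inequality holds on each slice; integrating it over θ and using translation
invariance removes the rotation. -/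
theorem integral_norm_trigPoly_sub_abschnitt_le (m : ℕ) (F : Finset MultiIndex)
    {a : FormalFourierSeries} (ha : spectrum a ⊆ analyticIndices) {κ : ℝ} (hκ : 0 < κ) :
    ∫ θ, ‖trigPoly F a θ - trigPoly F (abschnitt m a) θ‖ ∂haar ≤
      κ * ((∫ θ, ‖trigPoly F a θ‖ ∂haar) - ∫ θ, ‖trigPoly F (abschnitt m a) θ‖ ∂haar)
      + κ⁻¹ * ∫ θ, ‖trigPoly F a θ‖ ∂haar := by
  have hQ := continuous_trigPoly F a
  have hA := continuous_trigPoly F (abschnitt m a)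
  have hD : Continuous fun θ => ‖trigPoly F a θ - trigPoly F (abschnitt m a) θ‖ := by fun_prop
  have hQn : Continuous fun θ => ‖trigPoly F a θ‖ := by fun_prop
  have hAn : Integrable (fun θ => ‖trigPoly F (abschnitt m a) θ‖) haar :=
    integrable_of_continuous (by fun_prop)
  have hDi := (integrable_tailShift m hD).integral_prod_left
  have hQi := (integrable_tailShift m hQn).integral_prod_left
  simp only [Function.uncurry_apply_pair] at hDi hQi
  rw [← integral_integral_tailShift m hD, ← integral_integral_tailShift m hQn]
  have h1 : Integrable (fun θ => κ * ((∫ t, ‖trigPoly F a (θ + tailShift m t)‖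
      ∂AddCircle.haarAddCircle) - ‖trigPoly F (abschnitt m a) θ‖)) haar :=
    (hQi.sub hAn).const_mul _
  rw [← integral_sub hQi hAn, ← integral_const_mul, ← integral_const_mul,
    ← integral_add h1 (hQi.const_mul _)]
  refine integral_mono hDi (h1.add (hQi.const_mul _)) fun θ => ?_
  have h := integral_norm_eval_sub_le (slicePoly m F a θ) hκ
  simp only [eval_slicePoly m F ha, eval_zero_slicePoly m F ha] at h
  -- The section does not see the rotated variables, so it is constant along the slice.
  simpa only [trigPoly_abschnitt_add_tailShift] using h

end AnalyticPolynomials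

/-! ### Fejér kernels and means -/

section Fejer

theorem character_apply_sub (ν : MultiIndex) (θ φ : Torus) :
    character ν (θ - φ) = character ν θ * conj (character ν φ) := by
  have h := character_apply_add ν (θ - φ) φ
  rw [sub_add_cancel] at h
  rw [h, mul_assoc, Complex.mul_conj, Complex.normSq_eq_norm_sq, norm_character]
  simp

/-- The box of all multi-indices supported in `{0, …, N - 1}` with entries in `{0, …, N - 1}`. -/
def box (N : ℕ) : Finset MultiIndex := (Finset.range N).finsupp fun _ => Finset.Ico 0 (N : ℤ)

theorem card_box (N : ℕ) : (box N).card = N ^ N := by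
  simp [box]

theorem card_box_pos (N : ℕ) : 0 < (box N).card := by
  rw [card_box]
  rcases N.eq_zero_or_pos with rfl | h
  · simp
  · positivity

open Classical in
/-- The frequencies that occur in the Fejér kernel of order `N`. -/
def fejerIndices (N : ℕ) : Finset MultiIndex := (box N ×ˢ box N).image fun p => p.1 - p.2

open Classical in
/-- The coefficients of the Fejér kernel of order `N`. -/
def fejerWeight (N : ℕ) (η : MultiIndex) : ℂ :=
  (((box N ×ˢ box N).filter fun p => p.1 - p.2 = η).card : ℂ) / (box N).card

/-- The Fejér mean of order `N` of a formal Fourier series. -/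
def fejerMean (N : ℕ) (a : FormalFourierSeries) : Torus → ℂ :=
  trigPoly (fejerIndices N) fun η => fejerWeight N η * a η

/-- The Fejér kernel of order `N`. -/
def fejerKernel (N : ℕ) (θ : Torus) : ℝ :=
  ‖∑ ν ∈ box N, character ν θ‖ ^ 2 / (box N).card

theorem continuous_fejerKernel (N : ℕ) : Continuous (fejerKernel N) := by
  unfold fejerKernel
  have := continuous_character
  fun_prop

theorem fejerKernel_nonneg (N : ℕ) (θ : Torus) : 0 ≤ fejerKernel N θ := by
  unfold fejerKernel
  positivity

theorem fejerMean_eq_sum (N : ℕ) (a : FormalFourierSeries) (θ : Torus) :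
    fejerMean N a θ = (∑ p ∈ box N ×ˢ box N, a (p.1 - p.2) * character (p.1 - p.2) θ) /
      (box N).card := by
  classical
  rw [Finset.sum_comp (fun η => a η * character η θ) (fun p : MultiIndex × MultiIndex => p.1 - p.2),
    Finset.sum_div, fejerMean, trigPoly, fejerIndices]
  refine Finset.sum_congr (by congr!) fun η _ => ?_
  rw [fejerWeight, nsmul_eq_mul]
  ring_nf

theorem ofReal_fejerKernel (N : ℕ) (θ : Torus) :
    (fejerKernel N θ : ℂ) = (∑ p ∈ box N ×ˢ box N, character (p.1 - p.2) θ) / (box N).card := by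
  rw [fejerKernel, Complex.ofReal_div, Complex.ofReal_pow, ← Complex.mul_conj', map_sum,
    Finset.sum_mul_sum, Finset.sum_product]
  simp only [character_sub]
  simp

theorem integral_fejerKernel (N : ℕ) : ∫ θ, fejerKernel N θ ∂haar = 1 := by
  classical
  have h : ((∫ θ, fejerKernel N θ ∂haar : ℝ) : ℂ) = 1 := by
    rw [← integral_complex_ofReal]
    simp only [ofReal_fejerKernel]
    rw [integral_div, integral_finsetSum _ fun p _ =>
      integrable_of_continuous (continuous_character _)]
    simp only [integral_character, sub_eq_zero]
    rw [Finset.sum_product]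
    have hc : ((box N).card : ℂ) ≠ 0 := Nat.cast_ne_zero.2 (card_box_pos N).ne'
    simp [hc]
  exact_mod_cast h

theorem fejerMean_fourierCoefficient (N : ℕ) {f : Torus → ℂ} (hf : Integrable f haar)
    (θ : Torus) :
    fejerMean N (fourierCoefficient f) θ = ∫ φ, (fejerKernel N (θ - φ) : ℂ) * f φ ∂haar := by
  have h : ∀ φ, (fejerKernel N (θ - φ) : ℂ) * f φ = (∑ p ∈ box N ×ˢ box N,
      character (p.1 - p.2) θ * (conj (character (p.1 - p.2) φ) * f φ)) / (box N).card := by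
    intro φ
    rw [ofReal_fejerKernel, div_mul_eq_mul_div, Finset.sum_mul]
    simp only [character_apply_sub, mul_assoc]
  simp only [h]
  rw [integral_div, integral_finsetSum _ fun p _ =>
    (integrable_conj_character_mul (p.1 - p.2) hf).const_mul _, fejerMean_eq_sum]
  congr 1
  refine Finset.sum_congr rfl fun p _ => ?_
  rw [integral_const_mul, mul_comm, fourierCoefficient]

theorem continuous_fejerMean (N : ℕ) (a : FormalFourierSeries) : Continuous (fejerMean N a) :=
  continuous_trigPoly _ _

/-- The mean is a convolution with a nonnegative kernel of integral 1, so Fubini gives a contraction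
of L¹. -/
theorem integral_norm_fejerMean_le (N : ℕ) {f : Torus → ℂ} (hf : Integrable f haar) :
    ∫ θ, ‖fejerMean N (fourierCoefficient f) θ‖ ∂haar ≤ ∫ θ, ‖f θ‖ ∂haar := by
  obtain ⟨M, hM⟩ := (isCompact_range (continuous_fejerKernel N)).exists_bound_of_continuousOn
    continuousOn_id
  have hint : Integrable (Function.uncurry fun θ φ => fejerKernel N (θ - φ) * ‖f φ‖)
      (haar.prod haar) := by
    refine Integrable.bdd_mul (c := M) (hf.norm.comp_snd haar) ?_ (.of_forall fun x =>
      hM _ ⟨_, rfl⟩)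
    exact ((continuous_fejerKernel N).comp
      (continuous_fst.sub continuous_snd)).aestronglyMeasurable
  have hle : ∀ θ, ‖fejerMean N (fourierCoefficient f) θ‖ ≤
      ∫ φ, fejerKernel N (θ - φ) * ‖f φ‖ ∂haar := fun θ => by
    rw [fejerMean_fourierCoefficient N hf]
    refine (norm_integral_le_integral_norm _).trans_eq (integral_congr_ae (.of_forall fun φ => ?_))
    simp [abs_of_nonneg (fejerKernel_nonneg N _)]
  calc ∫ θ, ‖fejerMean N (fourierCoefficient f) θ‖ ∂haar
      ≤ ∫ θ, ∫ φ, fejerKernel N (θ - φ) * ‖f φ‖ ∂haar ∂haar :=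
        integral_mono (integrable_of_continuous (continuous_fejerMean N _)).norm
          hint.integral_prod_left hle
    _ = ∫ φ, ‖f φ‖ ∂haar := by
        rw [integral_integral_swap hint]
        refine integral_congr_ae (.of_forall fun φ => ?_)
        simp only [integral_mul_const]
        rw [integral_sub_right_eq_self (μ := haar) (fejerKernel N) φ, integral_fejerKernel,
          one_mul]

/-- Once `N` exceeds the support of η and every |η_j|, the weight is the finite product of the
one-variable weights 1 - |η_j|/N. -/
theorem tendsto_fejerWeight (η : MultiIndex) :
    Tendsto (fun N => fejerWeight N η) atTop (𝓝 1) := by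
  classical
  have key : ∀ N : ℕ, η.support ⊆ Finset.range N → 0 < N → fejerWeight N η =
      ∏ j ∈ η.support, (((N - |η j|).toNat : ℕ) : ℂ) / N := by
    intro N hs hN
    have hN0 : (N : ℂ) ≠ 0 := Nat.cast_ne_zero.2 hN.ne'
    have hcard : ((box N ×ˢ box N).filter fun p => p.1 - p.2 = η).card =
        ∏ j ∈ Finset.range N, (N - |η j|).toNat := by
      -- In each coordinate, ν_j and ν_j + η_j both lie in [0, N) for exactly N - |η_j| integers
      -- ν_j; `toNat` gives 0 when |η_j| > N.
      have h1 : ((Finset.range N).finsupp fun j =>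
          Finset.Ico (max 0 (-η j)) (min (N : ℤ) (N - η j))).card =
          ∏ j ∈ Finset.range N, (N - |η j|).toNat := by
        rw [Finset.card_finsupp]
        refine Finset.prod_congr rfl fun j _ => ?_
        rw [Int.card_Ico]
        congr 1
        rcases abs_cases (η j) with h | h <;> omega
      rw [← h1]
      symm
      refine Finset.card_bij (fun ν _ => (ν + η, ν)) ?_ ?_ ?_
      · intro ν hν
        rw [Finset.mem_finsupp_iff] at hν
        simp only [Finset.mem_filter, Finset.mem_product, add_sub_cancel_left, and_true, box,
          Finset.mem_finsupp_iff]
        refine ⟨⟨Finsupp.support_add.trans (Finset.union_subset hν.1 hs), fun j hj => ?_⟩,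
          hν.1, fun j hj => ?_⟩
        all_goals
          have := hν.2 j hj
          simp only [Finset.mem_Ico, Finsupp.add_apply] at this ⊢
          omega
      · intro ν _ ν' _ h
        exact (Prod.ext_iff.1 h).2
      · rintro ⟨ν, ν'⟩ h
        simp only [Finset.mem_filter, Finset.mem_product, box, Finset.mem_finsupp_iff] at h
        obtain ⟨⟨hν, hν'⟩, rfl⟩ := h
        refine ⟨ν', ?_, by simp⟩
        rw [Finset.mem_finsupp_iff]
        refine ⟨hν'.1, fun j hj => ?_⟩
        have a1 := hν.2 j hj
        have a2 := hν'.2 j hj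
        simp only [Finset.mem_Ico, Finsupp.sub_apply] at a1 a2 ⊢
        omega
    have hw : fejerWeight N η = ∏ j ∈ Finset.range N, (((N - |η j|).toNat : ℕ) : ℂ) / N := by
      rw [Finset.prod_div_distrib, Finset.prod_const, Finset.card_range, ← Nat.cast_prod, ← hcard,
        ← Nat.cast_pow, ← card_box, fejerWeight]
    rw [hw]
    symm
    refine Finset.prod_subset hs fun j _ hj => ?_
    rw [Finsupp.notMem_support_iff.1 hj]
    simp [hN0]
  have hlim : Tendsto (fun N : ℕ => ∏ j ∈ η.support, (((N - |η j|).toNat : ℕ) : ℂ) / N) atTop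
      (𝓝 (∏ j ∈ η.support, 1)) := by
    refine tendsto_finsetProd _ fun j _ => ?_
    have h0 : Tendsto (fun N : ℕ => (1 : ℂ) - (|η j| : ℤ) / N) atTop (𝓝 (1 - 0)) :=
      tendsto_const_nhds.sub (tendsto_const_div_atTop_nhds_zero_nat _)
    rw [sub_zero] at h0
    refine h0.congr' ?_
    filter_upwards [eventually_ge_atTop (|η j|.toNat + 1)] with N hN
    have hN0 : (N : ℂ) ≠ 0 := Nat.cast_ne_zero.2 (by omega)
    have h2 : (((N - |η j|).toNat : ℕ) : ℂ) = N - (|η j| : ℤ) := by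
      have h3 : (((N - |η j|).toNat : ℕ) : ℤ) = N - |η j| := Int.toNat_of_nonneg (by omega)
      exact_mod_cast congrArg (Int.cast : ℤ → ℂ) h3
    rw [h2, sub_div, div_self hN0]
  rw [Finset.prod_const_one] at hlim
  refine hlim.congr' ?_
  obtain ⟨n, hn⟩ := η.support.exists_nat_subset_range
  filter_upwards [eventually_ge_atTop (n + 1)] with N hN
  exact (key N (hn.trans (Finset.range_subset_range.2 (by omega))) (by omega)).symm

end Fejer

/-! ### Density of trigonometric polynomials -/

section Density

/-- The characters as continuous functions. -/
def characterMap (ν : MultiIndex) : C(Torus, ℂ) := ⟨character ν, continuous_character ν⟩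

/-- The star subalgebra of the continuous functions generated by the characters. -/
def characterSubalgebra : StarSubalgebra ℂ C(Torus, ℂ) where
  toSubalgebra := Algebra.adjoin ℂ (Set.range characterMap)
  star_mem' := by
    change Algebra.adjoin ℂ (Set.range characterMap) ≤
      star (Algebra.adjoin ℂ (Set.range characterMap))
    refine Algebra.adjoin_le ?_
    rintro _ ⟨ν, rfl⟩
    refine Algebra.subset_adjoin ⟨-ν, ?_⟩
    ext θ
    exact character_neg ν θ

/-- The characters are closed under multiplication, so products add nothing to their linear span. -/
theorem characterSubalgebra_coe :
    Subalgebra.toSubmodule characterSubalgebra.toSubalgebra =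
      Submodule.span ℂ (Set.range characterMap) := by
  refine Algebra.adjoin_eq_span_of_subset _ (Set.Subset.trans (fun x => ?_) Submodule.subset_span)
  refine Submonoid.closure_induction (fun _ => id) ⟨0, ?_⟩ ?_
  · ext θ
    exact character_zero θ
  · rintro _ _ _ _ ⟨ν, rfl⟩ ⟨η, rfl⟩
    refine ⟨ν + η, ?_⟩
    ext θ
    exact character_add ν η θ

theorem characterSubalgebra_separatesPoints :
    characterSubalgebra.toSubalgebra.SeparatesPoints := by
  intro θ φ h
  obtain ⟨j, hj⟩ := Function.ne_iff.1 h
  refine ⟨_, ⟨characterMap (Finsupp.single j 1), Algebra.subset_adjoin ⟨_, rfl⟩, rfl⟩, ?_⟩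
  change character _ θ ≠ character _ φ
  rw [character_single_one, character_single_one, fourier_one, fourier_one]
  exact fun h => hj (AddCircle.injective_toCircle one_ne_zero (Subtype.ext h))

/-- Stone–Weierstrass: the first-order characters already separate points. -/
theorem dense_span_characterMap :
    Dense (Submodule.span ℂ (Set.range characterMap) : Set C(Torus, ℂ)) := by
  have h := ContinuousMap.starSubalgebra_topologicalClosure_eq_top_of_separatesPoints _
    characterSubalgebra_separatesPoints
  rw [← characterSubalgebra_coe]
  intro f
  have hf : f ∈ characterSubalgebra.topologicalClosure := by rw [h]; trivial
  exact hf

theorem exists_trigPoly_eq {p : C(Torus, ℂ)}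
    (hp : p ∈ Submodule.span ℂ (Set.range characterMap)) :
    ∃ F a, (p : Torus → ℂ) = trigPoly F a := by
  obtain ⟨c, rfl⟩ := Finsupp.mem_span_range_iff_exists_finsupp.1 hp
  refine ⟨c.support, c, ?_⟩
  ext θ
  simp [Finsupp.sum, trigPoly, characterMap, ContinuousMap.sum_apply]

theorem exists_integral_norm_sub_trigPoly_lt {f : Torus → ℂ} (hf : Integrable f haar) {ε : ℝ}
    (hε : 0 < ε) : ∃ F a, ∫ θ, ‖f θ - trigPoly F a θ‖ ∂haar < ε := by
  have hd : DenseRange fun p : Submodule.span ℂ (Set.range characterMap) =>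
      ContinuousMap.toLp (E := ℂ) 1 haar ℂ (p : C(Torus, ℂ)) :=
    (ContinuousMap.toLp_denseRange ℂ haar ℂ ENNReal.one_ne_top).comp
      dense_span_characterMap.denseRange_val (ContinuousMap.toLp 1 haar ℂ).continuous
  obtain ⟨⟨p, hp⟩, h⟩ := hd.exists_dist_lt (hf.toL1 f) hε
  obtain ⟨F, a, hFa⟩ := exists_trigPoly_eq hp
  refine ⟨F, a, ?_⟩
  rw [dist_eq_norm, L1.norm_eq_integral_norm] at h
  refine lt_of_eq_of_lt (integral_congr_ae ?_) h
  filter_upwards [Lp.coeFn_sub (hf.toL1 f) (ContinuousMap.toLp (E := ℂ) 1 haar ℂ p),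
    hf.coeFn_toL1, ContinuousMap.coeFn_toLp haar (p := 1) (𝕜 := ℂ) p] with θ h1 h2 h3
  rw [h1, Pi.sub_apply, h2, h3, hFa]

end Density

/-! ### Convergence of Fejér means in L¹ -/

section FejerConvergence

theorem integrable_trigPoly (F : Finset MultiIndex) (a : FormalFourierSeries) :
    Integrable (trigPoly F a) haar :=
  integrable_of_continuous (continuous_trigPoly F a)

theorem fourierCoefficient_sub {f g : Torus → ℂ} (hf : Integrable f haar)
    (hg : Integrable g haar) (ν : MultiIndex) :
    fourierCoefficient (fun θ => f θ - g θ) ν = fourierCoefficient f ν - fourierCoefficient g ν := by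
  simp only [fourierCoefficient, mul_sub]
  exact integral_sub (integrable_conj_character_mul ν hf) (integrable_conj_character_mul ν hg)

open Classical in
theorem fourierCoefficient_trigPoly (F : Finset MultiIndex) (a : FormalFourierSeries)
    (ν : MultiIndex) : fourierCoefficient (trigPoly F a) ν = if ν ∈ F then a ν else 0 := by
  have h : ∀ θ, conj (character ν θ) * trigPoly F a θ =
      ∑ η ∈ F, a η * (conj (character ν θ) * character η θ) := fun θ => by
    rw [trigPoly, Finset.mul_sum]
    exact Finset.sum_congr rfl fun η _ => by ring
  simp only [fourierCoefficient, h]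
  rw [integral_finsetSum _ fun η _ => (integrable_conj_character_mul ν
    (integrable_of_continuous (continuous_character η))).const_mul _]
  simp only [integral_const_mul]
  have h2 : ∀ η, ∫ θ, conj (character ν θ) * character η θ ∂haar = if ν = η then 1 else 0 :=
    fun η => fourierCoefficient_character η ν
  simp [h2]

theorem fejerWeight_eq_zero {N : ℕ} {η : MultiIndex} (h : η ∉ fejerIndices N) :
    fejerWeight N η = 0 := by
  classical
  rw [fejerWeight, Finset.filter_eq_empty_iff.2, Finset.card_empty, Nat.cast_zero, zero_div]
  intro p hp hpη
  exact h (Finset.mem_image.2 ⟨p, hp, hpη⟩)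

theorem fejerMean_trigPoly (N : ℕ) (F : Finset MultiIndex) (a : FormalFourierSeries) (θ : Torus) :
    fejerMean N (fourierCoefficient (trigPoly F a)) θ =
      ∑ η ∈ F, fejerWeight N η * (a η * character η θ) := by
  classical
  rw [fejerMean, trigPoly]
  simp only [fourierCoefficient_trigPoly, mul_ite, mul_zero, ite_mul, zero_mul]
  rw [Finset.sum_ite_mem]
  simp only [mul_assoc]
  refine Finset.sum_subset Finset.inter_subset_right fun η hη h => ?_
  rw [fejerWeight_eq_zero fun hI => h (Finset.mem_inter.2 ⟨hI, hη⟩), zero_mul]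

theorem tendsto_fejerMean_trigPoly (F : Finset MultiIndex) (a : FormalFourierSeries) :
    Tendsto (fun N => ∫ θ, ‖fejerMean N (fourierCoefficient (trigPoly F a)) θ - trigPoly F a θ‖
      ∂haar) atTop (𝓝 0) := by
  have hle : ∀ N, ∫ θ, ‖fejerMean N (fourierCoefficient (trigPoly F a)) θ - trigPoly F a θ‖ ∂haar ≤
      ∑ η ∈ F, ‖fejerWeight N η - 1‖ * ‖a η‖ := fun N => by
    have h : ∀ θ, ‖fejerMean N (fourierCoefficient (trigPoly F a)) θ - trigPoly F a θ‖ ≤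
        ∑ η ∈ F, ‖fejerWeight N η - 1‖ * ‖a η‖ := fun θ => by
      rw [fejerMean_trigPoly, trigPoly, ← Finset.sum_sub_distrib]
      refine (norm_sum_le _ _).trans_eq (Finset.sum_congr rfl fun η _ => ?_)
      rw [← sub_one_mul, norm_mul, norm_mul, norm_character, mul_one]
    refine (integral_mono ((integrable_of_continuous (continuous_fejerMean N _)).sub
      (integrable_trigPoly F a)).norm (integrable_const _) h).trans_eq ?_
    simp
  refine squeeze_zero (fun N => integral_nonneg fun θ => norm_nonneg _) hle ?_
  rw [← Finset.sum_const_zero (s := F)]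
  refine tendsto_finsetSum _ fun η _ => ?_
  have h := (((tendsto_fejerWeight η).sub_const 1).norm).mul_const ‖a η‖
  simpa using h

theorem fejerMean_sub (N : ℕ) (a b : FormalFourierSeries) (θ : Torus) :
    fejerMean N (fun ν => a ν - b ν) θ = fejerMean N a θ - fejerMean N b θ := by
  simp only [fejerMean, trigPoly, mul_sub, sub_mul, Finset.sum_sub_distrib]

/-- The Fejér means of an integrable function converge to it in `L¹`. -/
theorem tendsto_fejerMean {f : Torus → ℂ} (hf : Integrable f haar) :
    Tendsto (fun N => ∫ θ, ‖fejerMean N (fourierCoefficient f) θ - f θ‖ ∂haar) atTop (𝓝 0) := by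
  rw [Metric.tendsto_atTop]
  intro ε hε
  -- Contractivity transfers the approximation error to the Fejér means, leaving three errors of
  -- size ε/3.
  obtain ⟨F, a, hFa⟩ := exists_integral_norm_sub_trigPoly_lt hf (show 0 < ε / 3 by positivity)
  obtain ⟨n, hn⟩ := Metric.tendsto_atTop.1 (tendsto_fejerMean_trigPoly F a) (ε / 3) (by positivity)
  refine ⟨n, fun N hN => ?_⟩
  have h1 := hn N hN
  rw [dist_zero_right, Real.norm_of_nonneg (integral_nonneg fun θ => norm_nonneg _)] at h1 ⊢
  have hp := integrable_trigPoly F a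
  have h2 := integral_norm_fejerMean_le N (hf.sub hp)
  have h3 : fourierCoefficient (f - trigPoly F a) =
      fun ν => fourierCoefficient f ν - fourierCoefficient (trigPoly F a) ν :=
    funext fun ν => fourierCoefficient_sub hf hp ν
  simp only [h3, fejerMean_sub, Pi.sub_apply] at h2
  have i1 : Integrable (fun θ => ‖fejerMean N (fourierCoefficient f) θ -
      fejerMean N (fourierCoefficient (trigPoly F a)) θ‖) haar :=
    ((integrable_of_continuous (continuous_fejerMean N _)).sub
      (integrable_of_continuous (continuous_fejerMean N _))).norm
  have i2 : Integrable (fun θ => ‖fejerMean N (fourierCoefficient (trigPoly F a)) θ -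
      trigPoly F a θ‖) haar :=
    ((integrable_of_continuous (continuous_fejerMean N _)).sub hp).norm
  have i3 : Integrable (fun θ => ‖f θ - trigPoly F a θ‖) haar := (hf.sub hp).norm
  have i12 : Integrable (fun θ => ‖fejerMean N (fourierCoefficient f) θ -
      fejerMean N (fourierCoefficient (trigPoly F a)) θ‖ +
      ‖fejerMean N (fourierCoefficient (trigPoly F a)) θ - trigPoly F a θ‖) haar := i1.add i2
  calc ∫ θ, ‖fejerMean N (fourierCoefficient f) θ - f θ‖ ∂haar
      ≤ ∫ θ, (‖fejerMean N (fourierCoefficient f) θ -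
          fejerMean N (fourierCoefficient (trigPoly F a)) θ‖ +
          ‖fejerMean N (fourierCoefficient (trigPoly F a)) θ - trigPoly F a θ‖ +
          ‖f θ - trigPoly F a θ‖) ∂haar := by
        refine integral_mono ((integrable_of_continuous (continuous_fejerMean N _)).sub hf).norm
          (i12.add i3) fun θ => ?_
        simp only
        rw [norm_sub_rev (f θ)]
        refine le_trans (le_of_eq ?_) norm_add₃_le
        congr 1
        ring
    _ < ε := by
        rw [integral_add i12 i3, integral_add i1 i2]
        linarith

theorem abs_integral_norm_sub_le {f g : Torus → ℂ} (hf : Integrable f haar)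
    (hg : Integrable g haar) :
    |(∫ θ, ‖f θ‖ ∂haar) - ∫ θ, ‖g θ‖ ∂haar| ≤ ∫ θ, ‖f θ - g θ‖ ∂haar := by
  rw [← integral_sub hf.norm hg.norm]
  refine (abs_integral_le_integral_abs).trans ?_
  exact integral_mono (hf.norm.sub hg.norm).norm (hf.sub hg).norm fun θ => abs_norm_sub_norm_le _ _

theorem tendsto_integral_norm_fejerMean {f : Torus → ℂ} (hf : Integrable f haar) :
    Tendsto (fun N => ∫ θ, ‖fejerMean N (fourierCoefficient f) θ‖ ∂haar) atTop
      (𝓝 (∫ θ, ‖f θ‖ ∂haar)) := by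
  rw [tendsto_iff_norm_sub_tendsto_zero]
  exact squeeze_zero (fun N => norm_nonneg _) (fun N => abs_integral_norm_sub_le
    (integrable_of_continuous (continuous_fejerMean N _)) hf) (tendsto_fejerMean hf)

end FejerConvergence

/-! ### The inequality for sections and the Cauchy property -/

section Main

/-- Both operations multiply coefficients by fixed factors, hence commute; the Fejér mean of a
section is again a section of a polynomial. -/
theorem fejerMean_abschnitt (N m : ℕ) (a : FormalFourierSeries) :
    fejerMean N (abschnitt m a) =
      trigPoly (fejerIndices N) (abschnitt m fun η => fejerWeight N η * a η) := by
  ext θ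
  refine Finset.sum_congr rfl fun η _ => ?_
  simp only [abschnitt, mul_ite, mul_zero]

theorem abschnitt_abschnitt {m n : ℕ} (h : m ≤ n) (a : FormalFourierSeries) :
    abschnitt m (abschnitt n a) = abschnitt m a := by
  ext ν
  simp only [abschnitt]
  split_ifs with h1 h2 <;> first | rfl | exact absurd (fun j hj => h1 j (h.trans hj)) h2

theorem spectrum_abschnitt_subset (m : ℕ) (a : FormalFourierSeries) :
    spectrum (abschnitt m a) ⊆ spectrum a := by
  intro ν hν h
  refine hν ?_
  simp only [abschnitt]
  split_ifs
  · exact h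
  · rfl

/-- If the norm of an analytic function is close to that of its section, then the function is close
to its section. -/
theorem integral_norm_sub_le_of_abschnitt (m : ℕ) {f g : Torus → ℂ} (hf : Integrable f haar)
    (hg : Integrable g haar) (hfa : spectrum (fourierCoefficient f) ⊆ analyticIndices)
    (hfg : fourierCoefficient g = abschnitt m (fourierCoefficient f)) {κ : ℝ} (hκ : 0 < κ) :
    ∫ θ, ‖f θ - g θ‖ ∂haar ≤
      κ * ((∫ θ, ‖f θ‖ ∂haar) - ∫ θ, ‖g θ‖ ∂haar) + κ⁻¹ * ∫ θ, ‖f θ‖ ∂haar := by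
  have hsub : Tendsto (fun N => ∫ θ, ‖fejerMean N (fourierCoefficient f) θ -
      fejerMean N (fourierCoefficient g) θ‖ ∂haar) atTop (𝓝 (∫ θ, ‖f θ - g θ‖ ∂haar)) := by
    have h := tendsto_integral_norm_fejerMean (hf.sub hg)
    have h3 : fourierCoefficient (f - g) =
        fun ν => fourierCoefficient f ν - fourierCoefficient g ν :=
      funext fun ν => fourierCoefficient_sub hf hg ν
    simpa only [h3, fejerMean_sub, Pi.sub_apply] using h
  have hF := tendsto_integral_norm_fejerMean hf
  have hG := tendsto_integral_norm_fejerMean hg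
  refine le_of_tendsto_of_tendsto' hsub (((hF.sub hG).const_mul κ).add (hF.const_mul κ⁻¹))
    fun N => ?_
  rw [hfg, fejerMean_abschnitt]
  refine integral_norm_trigPoly_sub_abschnitt_le m (fejerIndices N) (fun ν hν => hfa ?_) hκ
  exact right_ne_zero_of_mul hν

theorem norm_sub_le_of_abschnitt {a : FormalFourierSeries} (ha : spectrum a ⊆ analyticIndices)
    {m n : ℕ} (hmn : m ≤ n) {f g : Lp ℂ 1 haar} (hf : HasFourierSeries f (abschnitt n a))
    (hg : HasFourierSeries g (abschnitt m a)) {κ : ℝ} (hκ : 0 < κ) :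
    ‖f - g‖ ≤ κ * (‖f‖ - ‖g‖) + κ⁻¹ * ‖f‖ := by
  have hf' : fourierCoefficient f = abschnitt n a := funext hf
  have hg' : fourierCoefficient g = abschnitt m a := funext hg
  have h := integral_norm_sub_le_of_abschnitt m (L1.integrable_coeFn f) (L1.integrable_coeFn g)
    (by rw [hf']; exact (spectrum_abschnitt_subset n a).trans ha)
    (by rw [hf', hg', abschnitt_abschnitt hmn]) hκ
  rw [L1.norm_eq_integral_norm, L1.norm_eq_integral_norm, L1.norm_eq_integral_norm]
  refine le_of_eq_of_le (integral_congr_ae ?_) h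
  filter_upwards [Lp.coeFn_sub f g] with θ hθ
  rw [hθ, Pi.sub_apply]

theorem norm_fourierCoefficient_sub_le (f g : Lp ℂ 1 haar) (ν : MultiIndex) :
    ‖fourierCoefficient f ν - fourierCoefficient g ν‖ ≤ ‖f - g‖ := by
  rw [← fourierCoefficient_sub (L1.integrable_coeFn f) (L1.integrable_coeFn g),
    L1.norm_eq_integral_norm, fourierCoefficient]
  refine (norm_integral_le_integral_norm _).trans_eq (integral_congr_ae ?_)
  filter_upwards [Lp.coeFn_sub f g] with θ hθ
  rw [hθ, Pi.sub_apply, norm_mul, RCLike.norm_conj, norm_character, one_mul]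

theorem continuous_fourierCoefficient (ν : MultiIndex) :
    Continuous fun f : Lp ℂ 1 haar => fourierCoefficient f ν := by
  refine LipschitzWith.continuous (K := 1) (LipschitzWith.of_dist_le_mul fun f g => ?_)
  rw [NNReal.coe_one, one_mul, dist_eq_norm, dist_eq_norm]
  exact norm_fourierCoefficient_sub_le f g ν

/-- Large κ forces the norms to increase; as they are bounded, their increments tend to 0, and κ is
then fixed according to ε. -/
theorem cauchySeq_of_norm_sub_le {E : Type*} [SeminormedAddCommGroup E] {u : ℕ → E} {C : ℝ}
    (hC : ∀ n, ‖u n‖ ≤ C) (h : ∀ m n, m ≤ n → ∀ κ : ℝ, 0 < κ →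
      ‖u n - u m‖ ≤ κ * (‖u n‖ - ‖u m‖) + κ⁻¹ * ‖u n‖) : CauchySeq u := by
  have hC0 : 0 ≤ C := (norm_nonneg _).trans (hC 0)
  have hmono : Monotone fun n => ‖u n‖ := by
    intro m n hmn
    by_contra! hlt
    -- If the norm dropped, this κ would make the first term less than -C while the second is at
    -- most C, so the bound would be negative.
    obtain ⟨κ, hκ⟩ := exists_gt (max 1 (C / (‖u m‖ - ‖u n‖)))
    obtain ⟨h1, h2⟩ := max_lt_iff.1 hκ
    have hd : 0 < ‖u m‖ - ‖u n‖ := sub_pos.2 hlt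
    have h3 := h m n hmn κ (by linarith)
    rw [div_lt_iff₀ hd] at h2
    have h4 : κ⁻¹ * ‖u n‖ ≤ 1 * ‖u n‖ :=
      mul_le_mul_of_nonneg_right (inv_le_one_of_one_le₀ h1.le) (norm_nonneg _)
    have h5 := norm_nonneg (u n - u m)
    have h6 := hC n
    linarith
  have hconv := tendsto_atTop_ciSup hmono ⟨C, by rintro _ ⟨n, rfl⟩; exact hC n⟩
  have hcau := hconv.cauchySeq
  rw [Metric.cauchySeq_iff'] at hcau ⊢
  intro ε hε
  -- With this κ the term κ⁻¹‖u n‖ stays below ε/2, and increments below ε/(2κ) bound the other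
  -- term; C + 1 covers the case C = 0.
  have hκ : 0 < 2 * (C + 1) / ε := by positivity
  obtain ⟨m, hm⟩ := hcau (ε / (2 * (2 * (C + 1) / ε))) (by positivity)
  refine ⟨m, fun n hn => ?_⟩
  have h1 := (le_abs_self _).trans_lt ((Real.dist_eq _ _).symm.trans_lt (hm n hn))
  rw [lt_div_iff₀ (by positivity)] at h1
  have h2 := h m n hn _ hκ
  have h3 : (2 * (C + 1) / ε)⁻¹ * ‖u n‖ < ε / 2 := by
    rw [inv_div, div_mul_eq_mul_div, div_lt_div_iff₀ (by positivity) two_pos]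
    nlinarith [hC n]
  rw [dist_eq_norm]
  linarith

end Main

end InfTorus

end

theorem mainTheorem7 (μ : InfTorus.FormalFourierSeries) (C : ℝ)
    (hμ : InfTorus.spectrum μ ⊆ InfTorus.analyticIndices)
    (hA : ∀ m : ℕ, 1 ≤ m →
      ∃ g : InfTorus.H1, InfTorus.HasFourierSeries g (InfTorus.abschnitt m μ) ∧ ‖g‖ ≤ C) :
    ∃ f : InfTorus.H1, InfTorus.HasFourierSeries f μ ∧ ‖f‖ ≤ C := by
  -- The shift by 1 reflects that sections are only given for `m ≥ 1`.
  choose g hg hgC using fun n : ℕ => hA (n + 1) (Nat.le_add_left 1 n)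
  have hcau : CauchySeq fun n => (g n : Lp ℂ 1 InfTorus.haar) :=
    InfTorus.cauchySeq_of_norm_sub_le hgC fun m n hmn κ hκ =>
      InfTorus.norm_sub_le_of_abschnitt hμ (Nat.succ_le_succ hmn) (hg n) (hg m) hκ
  obtain ⟨f, hf⟩ := cauchySeq_tendsto_of_complete hcau
  have hfμ : InfTorus.HasFourierSeries f μ := fun ν => by
    refine tendsto_nhds_unique
      (((InfTorus.continuous_fourierCoefficient ν).tendsto f).comp hf) ?_
    -- The ν-th coefficient of the sections equals that of μ as soon as the section contains the
    -- support of ν.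
    refine tendsto_const_nhds.congr' ?_
    obtain ⟨n, hn⟩ := ν.support.exists_nat_subset_range
    filter_upwards [Filter.eventually_ge_atTop n] with k hk
    rw [Function.comp_apply, hg k ν, InfTorus.abschnitt, if_pos]
    intro j hj
    by_contra h0
    have := Finset.mem_range.1 (hn (Finsupp.mem_support_iff.2 h0))
    omega
  refine ⟨⟨f, fun ν hν => ?_⟩, hfμ, le_of_tendsto hf.norm (.of_forall hgC)⟩
  rw [hfμ ν]
  by_contra h0
  exact hν (hμ h0)
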